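/- Let $L$ be a first-order language and let $\mathcal U$ be a saturated $L$-structure whose cardinality $\kappa$ is an (uncountable, strongly) inaccessible cardinal larger than $|L|$. Let $n$ be a natural number and let $\mathcal D\subseteq\mathcal U^{n}$ be an arbitrary set. Write $\langle\mathcal U,\mathcal D\rangle$ for the expansion of $\mathcal U$ by a new $n$-ary predicate interpreted by $\mathcal D$. For $A\subseteq\mathcal U$ let $e(\mathcal D/A)$ be the family of all $\mathcal C\subseteq\mathcal U^{n}$ such that $\langle\mathcal U,\mathcal C\rangle$ and $\langle\mathcal U,\mathcal D\rangle$ satisfy the same sentences with parameters from $A$. A family $u$ of subsets of $\mathcal U^{n}$ has finite VC-dimension if for some $k<\omega$ no set $B\subseteq\mathcal U^{n}$ of size $k$ is shattered by $u$, where $u$ shatters $B$ if every $H\subseteq B$ equals $\mathcal C\cap B$ for some $\mathcal C\in u$. Suppose that $e(\mathcal D/A)$ has finite VC-dimension for some $A\subseteq\mathcal U$ with $|A|<\kappa$. Then 1. $\mathcal D$ is approximable from below: there is an $L$-formula $\varphi(x,z)$ without parameters, with $x$ a finite tuple of variables and $|z|=n$, such that for every finite $B\subseteq\mathcal U$ there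 is $b\in\mathcal U^{|x|}$ with $\varphi(b,\mathcal U)\cap B^{n}=\mathcal D\cap B^{n}$ and $\varphi(b,\mathcal U)\subseteq\mathcal D$, where $\varphi(b,\mathcal U)=\{a\in\mathcal U^{n}:\mathcal U\models\varphi(b,a)\}$; 2. $\mathcal D$ is approximable from above: there is an $L$-formula $\varphi(x,z)$ (possibly different from the one in 1) such that for every finite $B\subseteq\mathcal U$ there is $b\in\mathcal U^{|x|}$ with $\varphi(b,\mathcal U)\cap B^{n}=\mathcal D\cap B^{n}$ and $\mathcal D\subseteq\varphi(b,\mathcal U)$. In particular, $\mathcal D$ is externally definable: there are an $L$-formula $\varphi(x,z)$, with $x$ a finite tuple, and a complete type $p(x)$ over $\mathcal U$ such that $\mathcal D=\{a\in\mathcal U^{n}:\varphi(x,a)\in p\}$. -/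

import Mathlib

open FirstOrder Cardinal

universe u v w

namespace ExtDef

/-- `M` is saturated: every set of formulas in finitely many variables `x`, with parameters from a
set `A` of cardinality smaller than that of `M`, which is finitely satisfiable in `M` is realized
in `M`. A formula in `x` with parameters from `A` is given as an `L`-formula whose free variables
are elements of `A` (interpreted as themselves) and the variables `x`. -/
def IsSaturated (L : FirstOrder.Language.{u, v}) (M : Type w) [L.Structure M] : Prop :=
  ∀ A : Set M, #A < #M → ∀ (k : ℕ) (p : Set (L.Formula (A ⊕ Fin k))),
    (∀ s : Set (L.Formula (A ⊕ Fin k)), s.Finite → s ⊆ p →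
      ∃ b : Fin k → M, ∀ φ ∈ s, φ.Realize (Sum.elim ((↑) : A → M) b)) →
    ∃ b : Fin k → M, ∀ φ ∈ p, φ.Realize (Sum.elim ((↑) : A → M) b)

/-- The relation symbols of the language with exactly one relation symbol, of arity `n`. -/
inductive PredSymbol (n : ℕ) : ℕ → Type
  | mem : PredSymbol n n

/-- The language with exactly one symbol, a relation symbol of arity `n`. -/
def predLanguage (n : ℕ) : FirstOrder.Language.{0, 0} where
  Functions := fun _ => Empty
  Relations := PredSymbol n

/-- The expansion of `L` by a new `n`-ary predicate. -/
abbrev expLanguage (L : FirstOrder.Language.{u, v}) (n : ℕ) : FirstOrder.Language.{u, v} :=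
  L.sum (predLanguage n)

/-- The set `D ⊆ Mⁿ` as a structure in which the only symbol is interpreted by `D`. -/
@[reducible] def predStructure {M : Type w} {n : ℕ} (D : Set (Fin n → M)) :
    (predLanguage n).Structure M where
  funMap := fun f => Empty.elim f
  RelMap := fun r => match r with
    | PredSymbol.mem => fun a => a ∈ D

/-- The expansion `⟨M, D⟩` of the `L`-structure `M` by a predicate for `D ⊆ Mⁿ`. -/
@[reducible] def expansion (L : FirstOrder.Language.{u, v}) {M : Type w} [L.Structure M] {n : ℕ}
    (D : Set (Fin n → M)) : (expLanguage L n).Structure M :=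
  letI := predStructure D
  FirstOrder.Language.sumStructure L (predLanguage n) M

/-- `⟨M, C⟩ ≡_A ⟨M, D⟩`: the expansions by `C` and by `D` satisfy the same sentences with
parameters from `A`. -/
def EquivOver (L : FirstOrder.Language.{u, v}) {M : Type w} [L.Structure M] {n : ℕ} (A : Set M)
    (C D : Set (Fin n → M)) : Prop :=
  ∀ φ : (expLanguage L n).Formula A,
    (letI := expansion L C; φ.Realize ((↑) : A → M)) ↔
      (letI := expansion L D; φ.Realize ((↑) : A → M))

/-- The class `e(D/A)` of all `C` with `⟨M, C⟩ ≡_A ⟨M, D⟩`. -/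
def eClass (L : FirstOrder.Language.{u, v}) {M : Type w} [L.Structure M] {n : ℕ}
    (D : Set (Fin n → M)) (A : Set M) : Set (Set (Fin n → M)) :=
  {C | EquivOver L A C D}

/-- The family `F` shatters `B`: every subset of `B` is the trace on `B` of a member of `F`. -/
def Shatters {X : Type w} (F : Set (Set X)) (B : Set X) : Prop :=
  ∀ H ⊆ B, ∃ S ∈ F, S ∩ B = H

/-- The family `F` has finite VC-dimension: for some `k`, no set of size `k` is shattered. -/
def FiniteVCDim {X : Type w} (F : Set (Set X)) : Prop :=
  ∃ k : ℕ, ∀ B : Finset X, B.card = k → ¬ Shatters F (B : Set X)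

section Approximable

variable {L : FirstOrder.Language.{u, v}} {M : Type w} [L.Structure M] {m n : ℕ}

/-- The set `φ(b, M) ⊆ Mⁿ` for a formula `φ(x, z)` and a tuple `b` in the place of `x`. -/
def fiber (φ : L.Formula (Fin m ⊕ Fin n)) (b : Fin m → M) : Set (Fin n → M) :=
  {a | φ.Realize (Sum.elim b a)}

/-- The set `Bⁿ ⊆ Mⁿ`. -/
def power (B : Set M) (n : ℕ) : Set (Fin n → M) :=
  {a | ∀ i, a i ∈ B}

variable (L)

/-- `D` is approximable from below: for some formula `φ(x, z)`, for every finite `B` there is `b`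
with `φ(b, B) = D ∩ Bⁿ` and `φ(b, M) ⊆ D`. -/
def ApproximableFromBelow (D : Set (Fin n → M)) : Prop :=
  ∃ (m : ℕ) (φ : L.Formula (Fin m ⊕ Fin n)), ∀ B : Set M, B.Finite →
    ∃ b : Fin m → M, fiber φ b ∩ power B n = D ∩ power B n ∧ fiber φ b ⊆ D

/-- `D` is approximable from above: for some formula `φ(x, z)`, for every finite `B` there is `b`
with `φ(b, B) = D ∩ Bⁿ` and `D ⊆ φ(b, M)`. -/
def ApproximableFromAbove (D : Set (Fin n → M)) : Prop :=
  ∃ (m : ℕ) (φ : L.Formula (Fin m ⊕ Fin n)), ∀ B : Set M, B.Finite →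
    ∃ b : Fin m → M, fiber φ b ∩ power B n = D ∩ power B n ∧ D ⊆ fiber φ b

/-- Global types `p ∈ S_x(M)`, with `x` of length `m`: complete types over the theory of `M` in the
language with a constant for each element of `M`. -/
abbrev GlobalType (M : Type w) [L.Structure M] (m : ℕ) :=
  (L.elementaryDiagram M).CompleteType (Fin m)

variable {L}

open FirstOrder.Language in
/-- The formula `φ(x, a)` with parameters from `M`, for a formula `φ(x, z)` and a tuple `a` in the
place of `z`. -/
def plugIn (φ : L.Formula (Fin m ⊕ Fin n)) (a : Fin n → M) : L[[M]].Formula (Fin m) :=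
  BoundedFormula.subst ((L.lhomWithConstants M).onFormula φ)
    (Sum.elim (fun i => Term.var i) (fun j => (L.con (a j)).term))

variable (L)

/-- `D` is externally definable: `D = {a | φ(x, a) ∈ p}` for some global type `p(x)` and some
formula `φ(x, z)`. -/
def ExternallyDefinable (D : Set (Fin n → M)) : Prop :=
  ∃ (m : ℕ) (φ : L.Formula (Fin m ⊕ Fin n)) (p : GlobalType L M m),
    D = {a | FirstOrder.Language.Formula.equivSentence (plugIn φ a) ∈ p}

end Approximable

end ExtDef

/-!
For a set `E ⊆ Mⁿ`, the sets `X` all of whose finite subsets lie in instances `θ(d, M) ⊆ E` of one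
formula `θ` form an ideal (`CoveredInside`), and `E` is approximable from below once it belongs to
this ideal. Otherwise there is an ultrafilter `F` on `E` that avoids the ideal. The tuples that are
typical for the iterated products of `F` are then independent of `E`: every formula that holds of
almost all `k`-tuples holds of tuples with any prescribed pattern of membership in `E`
(`exists_pattern`). By saturation, for every `k` there is a `k`-tuple `a` whose type over `A` leaves
all patterns open (`exists_independent_tuple`).

Saturated structures are resplendent, so each of these patterns is realized by the tuple `a` itself
after `D` is replaced by some `C` in `e(D/A)` (`exists_mem_eClass_pattern`), and hence `e(D/A)`
shatters the entries of `a`. Resplendence is a Henkin construction in which partial theories are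
replaced by filters on the set of maps `v : M → M`. A map `v` stands for the reading in `⟨M, D⟩` of
a formula with parameters `x` as a statement about `v(x)`. The filter along which the elementary
diagram of `M` in `L` is preserved (`elementaryFilter`) is refined, along a well-order of `M` of
type `#M`, so that every existential formula gets a witness in `M` (`exists_witness`,
`exists_witnesses`): saturation provides the witness since fewer than `#M` parameters have been
constrained before. For an ultrafilter `V` below the final filter, let `C` consist of the tuples
that almost all `v` map into `D`. By the truth lemma `realizeIn_limitSet`, `⟨M, C⟩` satisfies what
`⟨M, D⟩` satisfies at almost all `v`.

The same argument with `E` the complement of `D` gives approximability from above, as complementing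
a pattern gives a pattern. Finally, an ultrafilter on the parameters of the approximations from
below yields a type that defines `D` externally.
-/

namespace ExtDef

open FirstOrder.Language Filter

/-! ### Formulas with parameters and saturation -/

section Formulas

variable {L : FirstOrder.Language.{u, v}} {M : Type w} [L.Structure M]

/-- Projections of definable sets are definable, uniformly: for a formula `χ` with variables in `α`,
the set of pairs `(w, x)` for which some valuation satisfying `χ` restricts to `w` on `S` and takes
the values `x` along `g` is defined by a formula, although `S` may be infinite and `g` need not be
injective. -/
theorem exists_projection [Nonempty M] {α : Type*} (S : Set α) {K : Type*} [Finite K] (g : K → α)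
    (χ : L.Formula α) :
    ∃ ψ : L.Formula (S ⊕ K), ∀ (w : S → M) (x : K → M), ψ.Realize (Sum.elim w x) ↔
      ∃ v : α → M, (∀ s : S, v s = w s) ∧ (∀ k, v (g k) = x k) ∧ χ.Realize v := by
  classical
  have := Fintype.ofFinite K
  let T : Finset α := χ.freeVarFinset ∪ Finset.univ.image g
  have hT : ∀ a ∈ χ.freeVarFinset, a ∈ T := fun a ha => Finset.mem_union_left _ ha
  have hg : ∀ k, g k ∈ T := fun k =>
    Finset.mem_union_right _ (Finset.mem_image_of_mem g (Finset.mem_univ k))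
  let χ' : L.Formula ((S ⊕ K) ⊕ T) := χ.restrictFreeVar fun t => Sum.inr ⟨t.1, hT t.1 t.2⟩
  let e₁ : L.Formula ((S ⊕ K) ⊕ T) := Formula.iInf fun t : {t : T // (t : α) ∈ S} =>
    Term.equal (Term.var (Sum.inr t.1)) (Term.var (Sum.inl (Sum.inl ⟨t.1.1, t.2⟩)))
  let e₂ : L.Formula ((S ⊕ K) ⊕ T) := Formula.iInf fun k : K =>
    Term.equal (Term.var (Sum.inr ⟨g k, hg k⟩)) (Term.var (Sum.inl (Sum.inr k)))
  have hχ : ∀ (y : S ⊕ K → M) (v : α → M),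
      χ'.Realize (Sum.elim y fun t : T => v t) ↔ χ.Realize v := fun y v =>
    BoundedFormula.realize_restrictFreeVar v (by intro a; rfl)
  refine ⟨(χ' ⊓ (e₁ ⊓ e₂)).iExs T, fun w x => ?_⟩
  rw [Formula.realize_iExs]
  simp only [Formula.realize_inf]
  have he₁ : ∀ t : T → M, e₁.Realize (Sum.elim (Sum.elim w x) t) ↔
      ∀ a : T, ∀ h : (a : α) ∈ S, t a = w ⟨a, h⟩ := by
    intro t
    simp [e₁, Formula.realize_iInf, Formula.realize_equal]
  have he₂ : ∀ t : T → M, e₂.Realize (Sum.elim (Sum.elim w x) t) ↔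
      ∀ k, t ⟨g k, hg k⟩ = x k := by
    intro t
    simp [e₂, Formula.realize_iInf, Formula.realize_equal]
  constructor
  · rintro ⟨t, h, h₁, h₂⟩
    rw [he₁] at h₁
    rw [he₂] at h₂
    let v : α → M := fun a => if h : a ∈ S then w ⟨a, h⟩ else
      if h : a ∈ T then t ⟨a, h⟩ else Classical.arbitrary M
    have hv : ∀ a : T, v a = t a := by
      intro a
      by_cases ha : (a : α) ∈ S
      · simp [v, ha, h₁ a ha]
      · simp [v, ha]
    refine ⟨v, fun s => by simp [v], fun k => (hv ⟨g k, hg k⟩).trans (h₂ k), ?_⟩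
    rw [← hχ (Sum.elim w x) v]
    rwa [show (fun a : T => v a) = t from funext hv]
  · rintro ⟨v, h₁, h₂, h⟩
    refine ⟨fun t => v t, (hχ _ v).2 h, ?_, ?_⟩
    · rw [he₁]
      exact fun a ha => h₁ ⟨a, ha⟩
    · rw [he₂]
      exact h₂

/-- A formula depends on finitely many of its parameter variables only. -/
theorem exists_finite_parameters {J K : Type*} (ψ : L.Formula (J ⊕ K)) :
    ∃ (m : ℕ) (f : Fin m → J) (θ : L.Formula (Fin m ⊕ K)), ∀ (d : J → M) (a : K → M),
      θ.Realize (Sum.elim (d ∘ f) a) ↔ ψ.Realize (Sum.elim d a) := by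
  classical
  let T : Finset J := ψ.freeVarFinset.toLeft
  have hT : ∀ j, Sum.inl j ∈ ψ.freeVarFinset → j ∈ T := fun j h => Finset.mem_toLeft.2 h
  let e := T.equivFin
  let r : ψ.freeVarFinset → Fin T.card ⊕ K := fun t => match t with
    | ⟨Sum.inl j, h⟩ => Sum.inl (e ⟨j, hT j h⟩)
    | ⟨Sum.inr k, _⟩ => Sum.inr k
  refine ⟨T.card, fun i => (e.symm i : J), ψ.restrictFreeVar r, fun d a => ?_⟩
  refine BoundedFormula.realize_restrictFreeVar (Sum.elim d a) ?_
  rintro ⟨j | k, h⟩ <;> simp [r]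

/-- Saturation, for types in variables indexed by an arbitrary finite type. -/
theorem IsSaturated.exists_realize (hM : IsSaturated L M) {A : Set M} (hA : #A < #M) {K : Type*}
    [Finite K] (p : Set (L.Formula (A ⊕ K)))
    (hp : ∀ s : Set (L.Formula (A ⊕ K)), s.Finite → s ⊆ p →
      ∃ b : K → M, ∀ φ ∈ s, φ.Realize (Sum.elim ((↑) : A → M) b)) :
    ∃ b : K → M, ∀ φ ∈ p, φ.Realize (Sum.elim ((↑) : A → M) b) := by
  obtain ⟨k, ⟨e⟩⟩ := Finite.exists_equiv_fin K
  let F : L.Formula (A ⊕ K) → L.Formula (A ⊕ Fin k) := Formula.relabel (Sum.map id e)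
  have hF : ∀ (φ : L.Formula (A ⊕ K)) (b : Fin k → M),
      (F φ).Realize (Sum.elim ((↑) : A → M) b) ↔
        φ.Realize (Sum.elim ((↑) : A → M) (b ∘ e)) := by
    intro φ b
    rw [Formula.realize_relabel, Sum.elim_comp_map]
    rfl
  obtain ⟨b, hb⟩ := hM A hA k (F '' p) (by
    intro s hs hsp
    obtain ⟨t, htp, ht, rfl⟩ := Set.exists_subset_image_finite_and.1 ⟨s, hsp, hs, rfl⟩
    obtain ⟨b, hb⟩ := hp t ht htp
    refine ⟨b ∘ e.symm, ?_⟩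
    rintro _ ⟨φ, hφ, rfl⟩
    rw [hF, Function.comp_assoc, Equiv.symm_comp_self]
    exact hb φ hφ)
  exact ⟨b ∘ e, fun φ hφ => (hF φ b).1 (hb _ ⟨φ, hφ, rfl⟩)⟩

end Formulas

/-! ### Independent tuples from failure of approximation -/

section Independence

variable {L : FirstOrder.Language.{u, v}} {M : Type w} [L.Structure M] {n : ℕ}

variable (L) in
/-- `X` is covered inside `E` when for one formula `θ(x, z)` every finite subset of `X` lies in an
instance `θ(d, M)` contained in `E`. -/
def CoveredInside (E X : Set (Fin n → M)) : Prop :=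
  ∃ (m : ℕ) (θ : L.Formula (Fin m ⊕ Fin n)), ∀ X₀ ⊆ X, X₀.Finite →
    ∃ d : Fin m → M, X₀ ⊆ fiber θ d ∧ fiber θ d ⊆ E

theorem CoveredInside.mono {E X Y : Set (Fin n → M)} (h : CoveredInside L E Y) (hXY : X ⊆ Y) :
    CoveredInside L E X := by
  obtain ⟨m, θ, hθ⟩ := h
  exact ⟨m, θ, fun X₀ hX₀ => hθ X₀ (hX₀.trans hXY)⟩

theorem coveredInside_empty (E : Set (Fin n → M)) : CoveredInside L E ∅ :=
  ⟨0, ⊥, fun _ hX₀ _ => ⟨Fin.elim0, fun _ ha => (hX₀ ha).elim, fun _ ha => False.elim ha⟩⟩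

theorem coveredInside_of_formula {E X : Set (Fin n → M)} {J : Type*} (ψ : L.Formula (J ⊕ Fin n))
    (h : ∀ X₀ ⊆ X, X₀.Finite → ∃ d : J → M, (∀ a ∈ X₀, ψ.Realize (Sum.elim d a)) ∧
      ∀ a, ψ.Realize (Sum.elim d a) → a ∈ E) : CoveredInside L E X := by
  obtain ⟨m, f, θ, hθ⟩ := exists_finite_parameters (M := M) ψ
  refine ⟨m, θ, fun X₀ hX₀ hfin => ?_⟩
  obtain ⟨d, h₁, h₂⟩ := h X₀ hX₀ hfin
  exact ⟨d ∘ f, fun a ha => (hθ d a).2 (h₁ a ha), fun a ha => h₂ a ((hθ d a).1 ha)⟩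

theorem CoveredInside.union {E X Y : Set (Fin n → M)} (hX : CoveredInside L E X)
    (hY : CoveredInside L E Y) : CoveredInside L E (X ∪ Y) := by
  obtain ⟨m, θ, hθ⟩ := hX
  obtain ⟨l, η, hη⟩ := hY
  let θ' : L.Formula ((Fin m ⊕ Fin l) ⊕ Fin n) := θ.relabel (Sum.map Sum.inl id)
  let η' : L.Formula ((Fin m ⊕ Fin l) ⊕ Fin n) := η.relabel (Sum.map Sum.inr id)
  refine coveredInside_of_formula (θ' ⊔ η') fun X₀ hX₀ hfin => ?_
  obtain ⟨d, hd₁, hd₂⟩ := hθ (X₀ ∩ X) Set.inter_subset_right (hfin.inter_of_left X)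
  obtain ⟨e, he₁, he₂⟩ := hη (X₀ ∩ Y) Set.inter_subset_right (hfin.inter_of_left Y)
  have key : ∀ a, (θ' ⊔ η').Realize (Sum.elim (Sum.elim d e) a) ↔
      a ∈ fiber θ d ∨ a ∈ fiber η e := by
    intro a
    rw [Formula.realize_sup, Formula.realize_relabel, Formula.realize_relabel, Sum.elim_comp_map,
      Sum.elim_comp_map, Sum.elim_comp_inl, Sum.elim_comp_inr]
    rfl
  refine ⟨Sum.elim d e, fun a ha => ?_, fun a ha => ?_⟩
  · rw [key]
    exact (hX₀ ha).imp (fun h => hd₁ ⟨ha, h⟩) fun h => he₁ ⟨ha, h⟩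
  · rw [key] at ha
    exact ha.elim (fun h => hd₂ h) fun h => he₂ h

theorem CoveredInside.approximableFromBelow {E : Set (Fin n → M)} (h : CoveredInside L E E) :
    ApproximableFromBelow L E := by
  obtain ⟨m, θ, hθ⟩ := h
  refine ⟨m, θ, fun B hB => ?_⟩
  have hBn : (power B n).Finite := by
    have := Set.Finite.pi' (t := fun _ : Fin n => B) fun _ => hB
    exact this
  obtain ⟨b, h₁, h₂⟩ := hθ (E ∩ power B n) Set.inter_subset_left (hBn.inter_of_right E)
  exact ⟨b, Set.Subset.antisymm (fun a ha => ⟨h₂ ha.1, ha.2⟩) fun a ha => ⟨h₁ ha, ha.2⟩, h₂⟩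

/-- If `E` is not approximable from below then some ultrafilter on `E` avoids the ideal of the sets
covered inside `E`. -/
theorem exists_ultrafilter_not_coveredInside {E : Set (Fin n → M)}
    (hE : ¬ ApproximableFromBelow L E) :
    ∃ F : Ultrafilter (Fin n → M), E ∈ F ∧ ∀ X ∈ F, ¬ CoveredInside L E X := by
  let f : Filter (Fin n → M) :=
    { sets := {X | CoveredInside L E (E \ X)}
      univ_sets := by
        change CoveredInside L E (E \ Set.univ)
        rw [Set.sdiff_univ]
        exact coveredInside_empty E
      sets_of_superset := fun hX hXY => CoveredInside.mono hX (Set.sdiff_subset_sdiff_right hXY)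
      inter_sets := fun {X Y} hX hY => by
        change CoveredInside L E (E \ (X ∩ Y))
        rw [Set.sdiff_inter]
        exact CoveredInside.union hX hY }
  have hf : ∀ X, X ∈ f ↔ CoveredInside L E (E \ X) := fun X => Iff.rfl
  have : f.NeBot := by
    rw [neBot_iff, Ne, ← empty_mem_iff_bot, hf, Set.sdiff_empty]
    exact fun h => hE h.approximableFromBelow
  refine ⟨Ultrafilter.of f, Ultrafilter.of_le f ?_, fun X hX hcov => ?_⟩
  · rw [hf, Set.sdiff_self]
    exact coveredInside_empty E
  · have : Xᶜ ∈ Ultrafilter.of f := Ultrafilter.of_le f <| by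
      rw [hf]
      exact hcov.mono fun a ha => not_not.1 ha.2
    exact Ultrafilter.compl_notMem_iff.2 hX this

/-- The iterated product of an ultrafilter with itself: `F`-many last entries `a` admit
`F ^ k`-many beginnings `z`. -/
def iteratedProduct {X : Type w} (F : Ultrafilter X) : (k : ℕ) → Ultrafilter (Fin k → X)
  | 0 => pure Fin.elim0
  | k + 1 => F.bind fun a => (iteratedProduct F k).map fun z => Fin.snoc z a

theorem eventually_iteratedProduct_succ {X : Type w} (F : Ultrafilter X) (k : ℕ)
    (P : (Fin (k + 1) → X) → Prop) :
    (∀ᶠ z in (iteratedProduct F (k + 1) : Filter (Fin (k + 1) → X)), P z) ↔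
      ∀ᶠ a in (F : Filter X), ∀ᶠ z in (iteratedProduct F k : Filter (Fin k → X)),
        P (Fin.snoc z a) :=
  Iff.rfl

/-- Every formula that holds for almost all `k`-tuples holds for tuples with an arbitrary pattern of
membership in `E`. A new entry inside `E` exists because `E` is large. For a new entry outside `E`,
let `X` be the large set of its possible values: as `X` is not covered inside `E`, there is a finite
`X₀ ⊆ X` such that every instance of the formula that contains `X₀` has a point outside `E`, and the
earlier entries are chosen so that the instance contains `X₀`. -/
theorem exists_pattern {E : Set (Fin n → M)} {F : Ultrafilter (Fin n → M)} (hE : E ∈ F)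
    (hF : ∀ X ∈ F, ¬ CoveredInside L E X) (k : ℕ) (H : Set (Fin k))
    (ψ : L.Formula (M ⊕ (Fin k × Fin n)))
    (hψ : ∀ᶠ z in (iteratedProduct F k : Filter (Fin k → Fin n → M)),
      ψ.Realize (Sum.elim id (Function.uncurry z))) :
    ∃ b : Fin k → Fin n → M, ψ.Realize (Sum.elim id (Function.uncurry b)) ∧
      ∀ i, b i ∈ E ↔ i ∈ H := by
  induction k with
  | zero =>
    obtain ⟨b, hb⟩ := hψ.exists
    exact ⟨b, hb, fun i => i.elim0⟩
  | succ k ih =>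
    rw [eventually_iteratedProduct_succ] at hψ
    -- the formula with the value `a` substituted for the last entry
    let r (a : Fin n → M) : M ⊕ (Fin (k + 1) × Fin n) → M ⊕ (Fin k × Fin n) :=
      Sum.elim Sum.inl fun q =>
        Fin.lastCases (motive := fun _ => M ⊕ (Fin k × Fin n)) (Sum.inl (a q.2))
          (fun i => Sum.inr (i, q.2)) q.1
    have hr : ∀ (a : Fin n → M) (z : Fin k → Fin n → M),
        Sum.elim id (Function.uncurry z) ∘ r a =
          Sum.elim id (Function.uncurry (Fin.snoc (α := fun _ => Fin n → M) z a)) := by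
      intro a z
      funext q
      rcases q with q | ⟨i, j⟩
      · rfl
      · refine Fin.lastCases ?_ (fun i => ?_) i <;> simp [r]
    have hψr : ∀ (a : Fin n → M) (z : Fin k → Fin n → M),
        (ψ.relabel (r a)).Realize (Sum.elim id (Function.uncurry z)) ↔
          ψ.Realize (Sum.elim id (Function.uncurry (Fin.snoc (α := fun _ => Fin n → M) z a))) := by
      intro a z
      rw [Formula.realize_relabel, hr]
    by_cases hH : Fin.last k ∈ H
    · obtain ⟨a, ha, haE⟩ := (hψ.and hE).exists
      obtain ⟨b, hb, hbH⟩ := ih {i | i.castSucc ∈ H} (ψ.relabel (r a)) (by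
        simpa only [hψr] using ha)
      refine ⟨Fin.snoc b a, (hψr a b).1 hb, fun i => ?_⟩
      refine Fin.lastCases ?_ (fun i => ?_) i
      · have haE' : a ∈ E := haE
        simpa [hH] using haE'
      · simpa using hbH i
    -- the formula with the last entry as its variable and the earlier entries among the parameters
    · let t : M ⊕ (Fin (k + 1) × Fin n) → (M ⊕ (Fin k × Fin n)) ⊕ Fin n :=
        Sum.elim (fun m => Sum.inl (Sum.inl m)) fun q =>
          Fin.lastCases (motive := fun _ => (M ⊕ (Fin k × Fin n)) ⊕ Fin n) (Sum.inr q.2)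
            (fun i => Sum.inl (Sum.inr (i, q.2))) q.1
      have ht : ∀ (a : Fin n → M) (z : Fin k → Fin n → M),
          (ψ.relabel t).Realize (Sum.elim (Sum.elim id (Function.uncurry z)) a) ↔
            ψ.Realize
              (Sum.elim id (Function.uncurry (Fin.snoc (α := fun _ => Fin n → M) z a))) := by
        intro a z
        rw [Formula.realize_relabel]
        refine iff_of_eq (congrArg ψ.Realize ?_)
        funext q
        rcases q with q | ⟨i, j⟩
        · rfl
        · refine Fin.lastCases ?_ (fun i => ?_) i <;> simp [t]
      have hX := mt (coveredInside_of_formula (ψ.relabel t)) (hF _ hψ)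
      push Not at hX
      obtain ⟨X₀, hX₀, hfin, hX₀E⟩ := hX
      have : Finite X₀ := hfin
      obtain ⟨b, hb, hbH⟩ := ih {i | i.castSucc ∈ H}
        (Formula.iInf fun a : X₀ => ψ.relabel (r a)) (by
          simp only [Formula.realize_iInf, hψr]
          rw [eventually_all]
          exact fun a => hX₀ a.2)
      rw [Formula.realize_iInf] at hb
      obtain ⟨a, ha, haE⟩ := hX₀E (Sum.elim id (Function.uncurry b)) fun a ha => by
        rw [ht, ← hψr]
        exact hb ⟨a, ha⟩
      refine ⟨Fin.snoc b a, (ht a b).1 ha, fun i => ?_⟩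
      refine Fin.lastCases ?_ (fun i => ?_) i
      · simpa [hH] using haE
      · simpa using hbH i

/-- If `E` is not approximable from below then there are tuples `a` of every length whose type over
`A` does not decide anything about membership of the entries in `E`. -/
theorem exists_independent_tuple (hM : IsSaturated L M) {A : Set M} (hA : #A < #M)
    {E : Set (Fin n → M)} (hE : ¬ ApproximableFromBelow L E) (k : ℕ) :
    ∃ a : Fin k → Fin n → M, ∀ (H : Set (Fin k)) (ψ : L.Formula (A ⊕ (Fin k × Fin n))),
      ψ.Realize (Sum.elim (↑) (Function.uncurry a)) →
        ∃ b : Fin k → Fin n → M, ψ.Realize (Sum.elim (↑) (Function.uncurry b)) ∧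
          ∀ i, b i ∈ E ↔ i ∈ H := by
  obtain ⟨F, hEF, hF⟩ := exists_ultrafilter_not_coveredInside hE
  let G := iteratedProduct F k
  obtain ⟨c, hc⟩ := hM.exists_realize hA
    {ψ : L.Formula (A ⊕ (Fin k × Fin n)) | ∀ᶠ z in (G : Filter (Fin k → Fin n → M)),
      ψ.Realize (Sum.elim (↑) (Function.uncurry z))} (by
    intro s hs hsp
    obtain ⟨z, hz⟩ := ((eventually_all_finite hs).2 fun φ hφ => hsp hφ).exists
    exact ⟨Function.uncurry z, hz⟩)
  refine ⟨Function.curry c, fun H ψ hψ => ?_⟩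
  rw [Function.uncurry_curry] at hψ
  have hψG : ∀ᶠ z in (G : Filter (Fin k → Fin n → M)),
      ψ.Realize (Sum.elim (↑) (Function.uncurry z)) := by
    by_contra h
    exact hc ψ.not (Ultrafilter.eventually_not.2 h) hψ
  have hlift : ∀ z : Fin k → Fin n → M,
      (ψ.relabel (Sum.map ((↑) : A → M) id)).Realize (Sum.elim id (Function.uncurry z)) ↔
        ψ.Realize (Sum.elim (↑) (Function.uncurry z)) := by
    intro z
    rw [Formula.realize_relabel, Sum.elim_comp_map]
    rfl
  obtain ⟨b, hb, hbH⟩ := exists_pattern hEF hF k H (ψ.relabel (Sum.map ((↑) : A → M) id)) (by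
    simpa only [hlift] using hψG)
  exact ⟨b, (hlift b).1 hb, hbH⟩

end Independence

/-! ### The Henkin construction along a well-order -/

section Henkin

variable (L : FirstOrder.Language.{u, v}) {M : Type w} [L.Structure M] {n : ℕ}

/-- The filter on the set of maps `M → M` along which the elementary diagram of `M` in `L` is
eventually preserved: it is generated by the sets `{v | M ⊨ χ(v)}`, for the formulas `χ` with
parameters from `M` that are true in `M`. -/
def elementaryFilter (M : Type w) [L.Structure M] : Filter (M → M) where
  sets := {X | ∃ χ : L.Formula M, χ.Realize id ∧ ∀ v : M → M, χ.Realize v → v ∈ X}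
  univ_sets := ⟨⊤, id, fun _ _ => trivial⟩
  sets_of_superset := fun ⟨χ, h, h'⟩ hXY => ⟨χ, h, fun v hv => hXY (h' v hv)⟩
  inter_sets := fun ⟨χ, h, h'⟩ ⟨ξ, k, k'⟩ =>
    ⟨χ ⊓ ξ, Formula.realize_inf.2 ⟨h, k⟩, fun v hv =>
      ⟨h' v (Formula.realize_inf.1 hv).1, k' v (Formula.realize_inf.1 hv).2⟩⟩

variable {L}

theorem mem_elementaryFilter {X : Set (M → M)} : X ∈ elementaryFilter L M ↔
    ∃ χ : L.Formula M, χ.Realize id ∧ ∀ v : M → M, χ.Realize v → v ∈ X :=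
  Iff.rfl

theorem eventually_realize {χ : L.Formula M} (h : χ.Realize id) :
    ∀ᶠ v in elementaryFilter L M, χ.Realize v :=
  ⟨χ, h, fun _ hv => hv⟩

/-- The filter `F` of maps on `M` is supported on `S`: it is generated by conditions on the
restrictions of the maps to `S`. -/
def SupportedOn (F : Filter (M → M)) (S : Set M) : Prop :=
  comap S.domRestrict (map S.domRestrict F) ≤ F

theorem SupportedOn.eventually_forall {F : Filter (M → M)} {S : Set M} (h : SupportedOn F S)
    {X : Set (M → M)} (hX : X ∈ F) : ∀ᶠ v in F, ∀ v', Set.EqOn v' v S → v' ∈ X := by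
  obtain ⟨Y, hY, hYX⟩ := h hX
  refine mem_of_superset (mem_map.1 hY) fun v hv v' hv' => hYX ?_
  have : S.domRestrict v' = S.domRestrict v := Set.domRestrict_eq_domRestrict_iff.2 hv'
  change S.domRestrict v' ∈ Y
  rwa [this]

theorem SupportedOn.mono {F : Filter (M → M)} {S T : Set M} (h : SupportedOn F S) (hST : S ⊆ T) :
    SupportedOn F T := by
  intro X hX
  refine ⟨{z | ∀ v, T.domRestrict v = z → v ∈ X}, ?_, fun v hv => hv v rfl⟩
  refine (h.eventually_forall hX).mono fun v hv v' hv' =>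
    hv v' ((Set.domRestrict_eq_domRestrict_iff.1 hv').mono hST)

theorem supportedOn_principal {X : Set (M → M)} {S : Set M}
    (h : ∀ v v', Set.EqOn v' v S → v ∈ X → v' ∈ X) : SupportedOn (𝓟 X) S := by
  rw [SupportedOn, map_principal, comap_principal, principal_mono]
  rintro v' ⟨v, hv, hvv'⟩
  exact h v v' (Set.domRestrict_eq_domRestrict_iff.1 hvv'.symm) hv

theorem SupportedOn.inf {F G : Filter (M → M)} {S : Set M} (hF : SupportedOn F S)
    (hG : SupportedOn G S) : SupportedOn (F ⊓ G) S :=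
  le_inf ((comap_mono (map_mono inf_le_left)).trans hF)
    ((comap_mono (map_mono inf_le_right)).trans hG)

theorem SupportedOn.iInf {ι : Sort*} {F : ι → Filter (M → M)} {S : Set M}
    (h : ∀ i, SupportedOn (F i) S) : SupportedOn (⨅ i, F i) S :=
  le_iInf fun i => (comap_mono (map_mono (iInf_le F i))).trans (h i)

/-- One step of the Henkin construction. Let `F` be supported on a small set and compatible with the
elementary diagram of `M`, and let `R` be a total relation between maps and points. Then some point
`c` of `M` may be made to satisfy `R v (v c)`: it realizes the type over the support of `F` of all
formulas that `F` forces on every `x` with `R v x`. -/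
theorem exists_witness (hM : IsSaturated L M) {F : Filter (M → M)} {S : Set M}
    (hS : #S < #M) (hF : SupportedOn F S) (hne : (F ⊓ elementaryFilter L M).NeBot)
    {R : (M → M) → M → Prop} (hRS : ∀ v v' x, Set.EqOn v' v S → R v x → R v' x)
    (hR : ∀ v, ∃ x, R v x) :
    ∃ c, (F ⊓ elementaryFilter L M ⊓ 𝓟 {v | R v (v c)}).NeBot := by
  classical
  have : Nonempty M := Cardinal.mk_ne_zero_iff.1 (ne_bot_of_gt hS)
  obtain ⟨b, hb⟩ := hM.exists_realize hS (K := Fin 1)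
    {ψ | ∀ᶠ v in F ⊓ elementaryFilter L M, ∀ x, R v x →
      ψ.Realize (Sum.elim (fun s : S => v s) fun _ => x)} (by
    intro s hs hsp
    have := hs.to_subtype
    let χ : L.Formula M := ((Formula.iInf fun φ : s => φ.1).relabel
      (Sum.map (↑) id : S ⊕ Fin 1 → M ⊕ Fin 1)).iExs (Fin 1)
    have hχ : ∀ v : M → M, χ.Realize v ↔
        ∃ y : Fin 1 → M, ∀ φ ∈ s, φ.Realize (Sum.elim (fun s : S => v s) y) := by
      intro v
      simp only [χ, Formula.realize_iExs, Formula.realize_relabel, Sum.elim_comp_map,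
        Formula.realize_iInf, Subtype.forall]
      rfl
    change ∃ y : Fin 1 → M, ∀ φ ∈ s, φ.Realize (Sum.elim (fun s : S => id s.1) y)
    rw [← hχ id]
    by_contra hcon
    have h₁ : ∀ᶠ v in F ⊓ elementaryFilter L M, χ.not.Realize v :=
      (eventually_realize (Formula.realize_not.2 hcon)).filter_mono inf_le_right
    obtain ⟨v, hv, hvs⟩ := (h₁.and ((eventually_all_finite hs).2 fun φ hφ => hsp hφ)).exists
    obtain ⟨x, hx⟩ := hR v
    exact hv ((hχ v).2 ⟨fun _ => x, fun φ hφ => hvs φ hφ x hx⟩))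
  refine ⟨b 0, ?_⟩
  by_contra hbot
  rw [not_neBot, inf_principal_eq_bot, mem_inf_iff] at hbot
  obtain ⟨X, hX, Y, hY, hXY⟩ := hbot
  obtain ⟨χ, hχ, hχY⟩ := mem_elementaryFilter.1 hY
  have hXχ : ∀ v ∈ X, χ.Realize v → ¬ R v (v (b 0)) := by
    intro v hv hv'
    have : v ∈ {v | R v (v (b 0))}ᶜ := hXY ▸ ⟨hv, hχY v hv'⟩
    exact this
  -- `F` forces that no `x` with `R v x` is the value at `b 0` of a map that agrees with `v` on `S`
  -- and satisfies `χ`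
  obtain ⟨ψ, hψ⟩ := exists_projection (M := M) S (fun _ : Fin 1 => b 0) χ
  have hmem : ∀ᶠ v in F ⊓ elementaryFilter L M, ∀ x, R v x →
      ψ.not.Realize (Sum.elim (fun s : S => v s) fun _ : Fin 1 => x) := by
    filter_upwards [(hF.eventually_forall hX).filter_mono inf_le_left] with v hv x hx
    rw [Formula.realize_not, hψ]
    rintro ⟨v', h₁, h₂, h₃⟩
    have heq : Set.EqOn v' v S := fun s hs => h₁ ⟨s, hs⟩
    refine hXχ v' (hv v' heq) h₃ ?_
    rw [h₂ 0]
    exact hRS v v' x heq hx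
  refine hb _ hmem ((hψ _ b).2 ⟨id, fun _ => rfl, fun k => ?_, hχ⟩)
  rw [Subsingleton.elim k 0]
  rfl

/-- The Henkin construction: witnesses `c i` for the `#M` many conditions `R i` may be chosen
simultaneously. They are chosen along a well-order of `M` with small initial segments, so that at
every step the filter constructed so far has a small support. -/
theorem exists_witnesses (hM : IsSaturated L M) (hM₀ : ℵ₀ < #M) {F : Filter (M → M)} {S : Set M}
    (hS : #S < #M) (hF : SupportedOn F S) (hne : (F ⊓ elementaryFilter L M).NeBot)
    (R : M → (M → M) → M → Prop) (T : M → Set M) (hT : ∀ i, (T i).Finite)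
    (hRT : ∀ i v v' x, Set.EqOn v' v (T i) → R i v x → R i v' x)
    (hR : ∀ i v, ∃ x, R i v x) :
    ∃ c : M → M, (F ⊓ elementaryFilter L M ⊓ ⨅ i, 𝓟 {v | R i v (v (c i))}).NeBot := by
  obtain ⟨r, hwo, hr⟩ := Cardinal.exists_ord_eq M
  have hseg : ∀ t : M, #{s // r s t} < #M := by
    intro t
    have h := Cardinal.card_typein_lt t hr
    rwa [← Ordinal.type_subrel, Ordinal.card_type] at h
  -- the filter reached before step `t`; it is supported on `S` together with finitely many points
  -- for every earlier step, one of them the witness chosen there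
  let G (t : M) (c : ∀ s, r s t → M) : Filter (M → M) :=
    F ⊓ ⨅ s, ⨅ h : r s t, 𝓟 {v | R s v (v (c s h))}
  have hstep : ∀ (t : M) (c : ∀ s, r s t → M), ∃ x, (G t c ⊓ elementaryFilter L M).NeBot →
      (G t c ⊓ elementaryFilter L M ⊓ 𝓟 {v | R t v (v x)}).NeBot := by
    intro t c
    by_cases h : (G t c ⊓ elementaryFilter L M).NeBot
    swap
    · exact ⟨t, fun h' => (h h').elim⟩
    let S' : Set M := S ∪ (T t ∪ ⋃ s : {s // r s t}, (T s ∪ {c s s.2}))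
    have hcard : #S' < #M := by
      refine (Cardinal.mk_union_le _ _).trans_lt (Cardinal.add_lt_of_lt hM₀.le hS ?_)
      refine (Cardinal.mk_union_le _ _).trans_lt (Cardinal.add_lt_of_lt hM₀.le ?_ ?_)
      · exact ((hT t).lt_aleph0).trans hM₀
      · refine (Cardinal.mk_iUnion_le _).trans_lt ?_
        refine (mul_le_mul_right (ciSup_le' (a := ℵ₀) fun s => ?_) _).trans_lt
          (Cardinal.mul_lt_of_lt hM₀.le (hseg t) hM₀)
        exact (((hT s).union (Set.finite_singleton _)).lt_aleph0).le
    have hsub : ∀ s (h : r s t), T s ∪ {c s h} ⊆ S' := fun s h =>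
      (Set.subset_iUnion (fun s : {s // r s t} => T s ∪ {c s s.2}) ⟨s, h⟩).trans
        (Set.subset_union_right.trans Set.subset_union_right)
    have hG : SupportedOn (G t c) S' := by
      refine (hF.mono Set.subset_union_left).inf (SupportedOn.iInf fun s =>
        SupportedOn.iInf fun h => supportedOn_principal fun v v' hvv' hv => ?_)
      have h₁ : v' (c s h) = v (c s h) := hvv' (hsub s h (Or.inr rfl))
      change R s v' (v' (c s h))
      rw [h₁]
      exact hRT s v v' _ (hvv'.mono (Set.subset_union_left.trans (hsub s h))) hv
    obtain ⟨x, hx⟩ := exists_witness hM hcard hG h (R := R t)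
      (fun v v' x hvv' => hRT t v v' x
        (hvv'.mono (Set.subset_union_left.trans Set.subset_union_right))) (hR t)
    exact ⟨x, fun _ => hx⟩
  choose x hx using hstep
  let c : M → M := hwo.wf.fix x
  have hc : ∀ t, c t = x t fun s _ => c s := fun t => hwo.wf.fix_eq x t
  -- the filter reached after step `t`
  let Q (t : M) : Filter (M → M) :=
    G t (fun s _ => c s) ⊓ elementaryFilter L M ⊓ 𝓟 {v | R t v (v (c t))}
  have hQ_anti : ∀ s t, r s t → Q t ≤ Q s := by
    intro s t hst
    refine le_inf (inf_le_left.trans (inf_le_inf_right _ (inf_le_inf_left F ?_))) ?_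
    · exact le_iInf fun a => le_iInf fun ha => iInf₂_le a (trans_of r ha hst)
    · exact inf_le_left.trans (inf_le_left.trans (inf_le_right.trans (iInf₂_le s hst)))
  have hQ_dir : ∀ s t, ∃ a, (a = s ∨ a = t) ∧ Q a ≤ Q s ∧ Q a ≤ Q t := by
    intro s t
    rcases trichotomous_of r s t with h | rfl | h
    · exact ⟨t, Or.inr rfl, hQ_anti s t h, le_rfl⟩
    · exact ⟨s, Or.inl rfl, le_rfl, le_rfl⟩
    · exact ⟨s, Or.inl rfl, le_rfl, hQ_anti t s h⟩
  have hQ : ∀ t, (Q t).NeBot := by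
    intro t
    induction t using hwo.wf.induction with
    | _ t ih =>
      have hGt : (G t (fun s _ => c s) ⊓ elementaryFilter L M).NeBot := by
        by_cases hempty : ∃ s, r s t
        · obtain ⟨s₀, hs₀⟩ := hempty
          have : Nonempty {s // r s t} := ⟨⟨s₀, hs₀⟩⟩
          have hinf : (⨅ s : {s // r s t}, Q s).NeBot := by
            refine iInf_neBot_of_directed' ?_ fun s => ih s s.2
            rintro ⟨s, hs⟩ ⟨s', hs'⟩
            obtain ⟨a, rfl | rfl, h₁, h₂⟩ := hQ_dir s s'
            · exact ⟨⟨a, hs⟩, h₁, h₂⟩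
            · exact ⟨⟨a, hs'⟩, h₁, h₂⟩
          refine hinf.mono (le_inf (le_inf ?_ (le_iInf₂ fun s hs => ?_)) ?_)
          · exact (iInf_le _ ⟨s₀, hs₀⟩).trans (inf_le_left.trans (inf_le_left.trans inf_le_left))
          · exact (iInf_le _ ⟨s, hs⟩).trans inf_le_right
          · exact (iInf_le _ ⟨s₀, hs₀⟩).trans (inf_le_left.trans inf_le_right)
        · refine hne.mono (inf_le_inf_right _ (le_inf le_rfl (le_iInf₂ fun s hs => ?_)))
          exact (hempty ⟨s, hs⟩).elim
      have := hx t _ hGt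
      rwa [← hc t] at this
  have : Nonempty M := Cardinal.mk_ne_zero_iff.1 (ne_bot_of_gt hM₀)
  have hinf : (⨅ t, Q t).NeBot := by
    refine iInf_neBot_of_directed' (fun s t => ?_) hQ
    obtain ⟨a, -, h₁, h₂⟩ := hQ_dir s t
    exact ⟨a, h₁, h₂⟩
  refine ⟨c, hinf.mono (le_inf (le_inf ?_ ?_) (le_iInf fun i => ?_))⟩
  · exact (iInf_le _ this.some).trans (inf_le_left.trans (inf_le_left.trans inf_le_left))
  · exact (iInf_le _ this.some).trans (inf_le_left.trans inf_le_right)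
  · exact (iInf_le _ i).trans inf_le_right

end Henkin

/-! ### Resplendence of saturated structures -/

/-- There are at most `#M` many formulas with tuples of points of `M` in the place of all but one of
their bound variables. -/
theorem exists_surjective_tasks (L : FirstOrder.Language.{u, v}) {M : Type w} (hM₀ : ℵ₀ < #M)
    (hL : Cardinal.lift.{w} L.card < Cardinal.lift.{max u v} #M) (n : ℕ) (A : Set M) :
    ∃ f : M → Σ k, (expLanguage L n).BoundedFormula A (k + 1) × (Fin k → M),
      Function.Surjective f := by
  have : Nonempty M := Cardinal.mk_ne_zero_iff.1 (ne_bot_of_gt hM₀)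
  have : Infinite M := Cardinal.infinite_iff.2 hM₀.le
  have hpred : (predLanguage n).card ≤ ℵ₀ := by
    have h₁ : Countable (Σ l, (predLanguage n).Functions l) :=
      ⟨⟨fun x => Empty.elim x.2, fun x => Empty.elim x.2⟩⟩
    have h₂ : Countable (Σ l, (predLanguage n).Relations l) := by
      refine ⟨⟨fun x => x.1, ?_⟩⟩
      rintro ⟨_, ⟨⟩⟩ ⟨_, ⟨⟩⟩ -
      rfl
    have : Countable (predLanguage n).Symbols := inferInstanceAs (Countable (_ ⊕ _))
    exact Cardinal.mk_le_aleph0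
  have hlift : ℵ₀ ≤ Cardinal.lift.{max u v} #M := by
    rw [Cardinal.aleph0_le_lift]
    exact hM₀.le
  have hcard : Cardinal.lift.{w} (expLanguage L n).card ≤ Cardinal.lift.{max u v} #M := by
    rw [Language.card_sum, Cardinal.lift_add]
    refine Cardinal.add_le_of_le hlift ?_ ?_
    · simpa using hL.le
    · refine le_trans ?_ hlift
      simpa using hpred
  have hform : #(Σ k, (expLanguage L n).BoundedFormula A k) ≤ Cardinal.lift.{max u v} #M := by
    refine BoundedFormula.card_le.trans (max_le hlift (Cardinal.add_le_of_le hlift ?_ hcard))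
    exact Cardinal.lift_le.2 (Cardinal.mk_set_le A)
  rw [← Cardinal.mk_uLift] at hform
  obtain ⟨e₀⟩ := hform
  let e := e₀.trans Equiv.ulift.toEmbedding
  obtain ⟨e'⟩ : Nonempty (M × List M ≃ M) := by
    rw [← Cardinal.eq, Cardinal.mk_prod, Cardinal.mk_list_eq_mk]
    simp
  let g : (Σ k, (expLanguage L n).BoundedFormula A (k + 1) × (Fin k → M)) → M :=
    fun x => e' (e ⟨x.1 + 1, x.2.1⟩, List.ofFn x.2.2)
  have hg : Function.Injective g := by
    rintro ⟨k, φ, xs⟩ ⟨k', φ', xs'⟩ h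
    have h := Prod.ext_iff.1 (e'.injective h)
    have h₁ := e.injective h.1
    have h₂ := h.2
    simp only [Sigma.mk.injEq, Nat.add_right_cancel_iff] at h₁
    obtain ⟨rfl, h₁⟩ := h₁
    obtain rfl := eq_of_heq h₁
    obtain rfl := List.ofFn_injective h₂
    rfl
  have : Nonempty (Σ k, (expLanguage L n).BoundedFormula A (k + 1) × (Fin k → M)) :=
    ⟨⟨0, ⊥, Fin.elim0⟩⟩
  exact ⟨Function.invFun g, Function.invFun_surjective hg⟩

section Expansion

variable (L : FirstOrder.Language.{u, v}) {M : Type w} [L.Structure M] {n : ℕ}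

/-- The truth of a formula with parameters in the expansion `⟨M, D⟩`. -/
def RealizeIn {A : Set M} (D : Set (Fin n → M)) {k : ℕ}
    (φ : (expLanguage L n).BoundedFormula A k) (xs : Fin k → M) : Prop :=
  letI := expansion L D
  φ.Realize ((↑) : A → M) xs

variable {L}

/-- Along the elementary filter, maps eventually commute with the terms of the expanded language,
whose interpretation does not depend on the predicate. -/
theorem eventually_realize_term {ι : Type*} (C D : Set (Fin n → M))
    (t : (expLanguage L n).Term ι) (y : ι → M) :
    ∀ᶠ v in elementaryFilter L M,
      (letI := expansion L D; t.realize (v ∘ y)) = v (letI := expansion L C; t.realize y) := by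
  induction t with
  | var i => exact Eventually.of_forall fun v => rfl
  | @func l f ts ih =>
    rcases f with f | f
    swap
    · exact f.elim
    let z : Fin l → M := fun i => letI := expansion L C; (ts i).realize y
    let χ : L.Formula M := Term.equal (Term.func f fun i => Term.var (z i))
      (Term.var (Structure.funMap f z))
    have hχ : ∀ v : M → M, χ.Realize v ↔ Structure.funMap f (v ∘ z) = v (Structure.funMap f z) := by
      intro v
      simp only [χ, Formula.realize_equal]
      rfl
    filter_upwards [eventually_all.2 ih, eventually_realize ((hχ id).2 rfl)] with v hv hvχ
    rw [hχ] at hvχ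
    refine Eq.trans ?_ hvχ
    exact congrArg (Structure.funMap f) (funext fun i => hv i)

/-- The set that the ultrafilter `V` of maps on `M` assigns to `D`: it contains a tuple when almost
all maps send this tuple into `D`. -/
def limitSet (V : Ultrafilter (M → M)) (D : Set (Fin n → M)) : Set (Fin n → M) :=
  {a | ∀ᶠ v in (V : Filter (M → M)), v ∘ a ∈ D}

/-- The truth lemma of the Henkin construction. -/
theorem realizeIn_limitSet {A : Set M} {D : Set (Fin n → M)} {V : Ultrafilter (M → M)}
    (hV : (V : Filter (M → M)) ≤ elementaryFilter L M)
    (hVA : ∀ᶠ v in (V : Filter (M → M)), ∀ a ∈ A, v a = a)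
    (hHenkin : ∀ (k : ℕ) (φ : (expLanguage L n).BoundedFormula A (k + 1)) (xs : Fin k → M),
      ∃ c, ∀ᶠ v in (V : Filter (M → M)), (∃ y, ¬ RealizeIn L D φ (Fin.snoc (v ∘ xs) y)) →
        ¬ RealizeIn L D φ (Fin.snoc (v ∘ xs) (v c)))
    {k : ℕ} (φ : (expLanguage L n).BoundedFormula A k) (xs : Fin k → M) :
    RealizeIn L (limitSet V D) φ xs ↔
      ∀ᶠ v in (V : Filter (M → M)), RealizeIn L D φ (v ∘ xs) := by
  -- eventually, `v` commutes with the terms in `xs` and parameters from `A`, as it fixes `A`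
  have hterm : ∀ {k : ℕ} (t : (expLanguage L n).Term (A ⊕ Fin k)) (xs : Fin k → M),
      ∀ᶠ v in (V : Filter (M → M)),
        (letI := expansion L D; t.realize (Sum.elim ((↑) : A → M) (v ∘ xs))) =
          v (letI := expansion L (limitSet V D); t.realize (Sum.elim ((↑) : A → M) xs)) := by
    intro k t xs
    filter_upwards [hVA, hV (eventually_realize_term (limitSet V D) D t
      (Sum.elim ((↑) : A → M) xs))] with v hvA hv
    rw [← hv]
    have : Sum.elim ((↑) : A → M) (v ∘ xs) = v ∘ Sum.elim ((↑) : A → M) xs := by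
      funext i
      rcases i with a | i
      · exact (hvA a a.2).symm
      · rfl
    rw [this]
  induction φ with
  | falsum => exact ⟨fun h => h.elim, fun h => h.exists.choose_spec.elim⟩
  | @equal k t₁ t₂ =>
    let z (t : (expLanguage L n).Term (A ⊕ Fin k)) : M :=
      letI := expansion L (limitSet V D)
      t.realize (Sum.elim ((↑) : A → M) xs)
    have h : ∀ᶠ v in (V : Filter (M → M)),
        (RealizeIn L D (BoundedFormula.equal t₁ t₂) (v ∘ xs) ↔ v (z t₁) = v (z t₂)) := by
      filter_upwards [hterm t₁ xs, hterm t₂ xs] with v h₁ h₂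
      rw [← h₁, ← h₂]
      rfl
    rw [eventually_congr h]
    change z t₁ = z t₂ ↔ _
    constructor
    · intro h
      exact Eventually.of_forall fun v => by rw [h]
    · intro h
      by_contra hne
      let χ : L.Formula M := (Term.equal (Term.var (z t₁)) (Term.var (z t₂))).not
      have hχ : ∀ v : M → M, χ.Realize v ↔ ¬ v (z t₁) = v (z t₂) := by
        intro v
        rw [Formula.realize_not, Formula.realize_equal]
        rfl
      obtain ⟨v, hv, hv'⟩ := (h.and (hV (eventually_realize ((hχ id).2 hne)))).exists
      exact (hχ v).1 hv' hv
  | @rel k l R ts =>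
    let z (i : Fin l) : M :=
      letI := expansion L (limitSet V D)
      (ts i).realize (Sum.elim ((↑) : A → M) xs)
    rcases R with R | R
    · have h : ∀ᶠ v in (V : Filter (M → M)),
          (RealizeIn L D (BoundedFormula.rel (Sum.inl R) ts) (v ∘ xs) ↔
            Structure.RelMap R (v ∘ z)) := by
        filter_upwards [eventually_all.2 fun i => hterm (ts i) xs] with v hv
        have : v ∘ z = fun i => letI := expansion L D; (ts i).realize
            (Sum.elim ((↑) : A → M) (v ∘ xs)) := funext fun i => (hv i).symm
        rw [this]
        rfl
      rw [eventually_congr h]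
      change Structure.RelMap R z ↔ _
      let χ : L.Formula M := R.formula fun i => Term.var (z i)
      have hχ : ∀ v : M → M, χ.Realize v ↔ Structure.RelMap R (v ∘ z) := by
        intro v
        simp only [χ, Formula.realize_rel]
        rfl
      constructor
      · intro hz
        have h' : ∀ᶠ v in (V : Filter (M → M)), χ.Realize v :=
          hV (eventually_realize ((hχ id).2 hz))
        exact h'.mono fun v hv => (hχ v).1 hv
      · intro hz
        by_contra hne
        have hne' : χ.not.Realize id := Formula.realize_not.2 fun h' => hne ((hχ id).1 h')
        obtain ⟨v, hv, hv'⟩ := (hz.and (hV (eventually_realize hne'))).exists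
        exact Formula.realize_not.1 hv' ((hχ v).2 hv)
    · cases R
      have h : ∀ᶠ v in (V : Filter (M → M)),
          (RealizeIn L D (BoundedFormula.rel (Sum.inr PredSymbol.mem) ts) (v ∘ xs) ↔
            v ∘ z ∈ D) := by
        filter_upwards [eventually_all.2 fun i => hterm (ts i) xs] with v hv
        have : v ∘ z = fun i => letI := expansion L D; (ts i).realize
            (Sum.elim ((↑) : A → M) (v ∘ xs)) := funext fun i => (hv i).symm
        rw [this]
        rfl
      rw [eventually_congr h]
      rfl
  | imp φ₁ φ₂ ih₁ ih₂ =>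
    change (RealizeIn L (limitSet V D) φ₁ xs → RealizeIn L (limitSet V D) φ₂ xs) ↔
      ∀ᶠ v in (V : Filter (M → M)), (RealizeIn L D φ₁ (v ∘ xs) → RealizeIn L D φ₂ (v ∘ xs))
    exact (imp_congr (ih₁ xs) (ih₂ xs)).trans Ultrafilter.eventually_imp.symm
  | @all k φ ih =>
    change (∀ x, RealizeIn L (limitSet V D) φ (Fin.snoc xs x)) ↔
      ∀ᶠ v in (V : Filter (M → M)), ∀ y, RealizeIn L D φ (Fin.snoc (v ∘ xs) y)
    have hsnoc : ∀ (v : M → M) (x : M),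
        v ∘ (Fin.snoc xs x : Fin (k + 1) → M) = Fin.snoc (v ∘ xs) (v x) := fun v x =>
      Fin.comp_snoc v xs x
    simp only [ih, hsnoc]
    constructor
    · intro h
      obtain ⟨c, hc⟩ := hHenkin k φ xs
      filter_upwards [hc, h c] with v hv hvc
      by_contra hcon
      push Not at hcon
      exact hv hcon hvc
    · intro h x
      exact h.mono fun v hv => hv (v x)

/-- Saturated structures are resplendent: if conditions `F` with small support on maps of `M` into
`⟨M, D⟩` are compatible with the elementary diagram of `M` and fix `A`, then they are met by an
expansion of `M` that is equivalent over `A` to `⟨M, D⟩`. -/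
theorem exists_limitSet_mem_eClass (hM : IsSaturated L M) (hM₀ : ℵ₀ < #M)
    (hL : Cardinal.lift.{w} L.card < Cardinal.lift.{max u v} #M) {A : Set M}
    (D : Set (Fin n → M)) {F : Filter (M → M)} {S : Set M} (hS : #S < #M) (hF : SupportedOn F S)
    (hne : (F ⊓ elementaryFilter L M).NeBot) (hFA : ∀ᶠ v in F, ∀ a ∈ A, v a = a) :
    ∃ V : Ultrafilter (M → M), (V : Filter (M → M)) ≤ F ∧ limitSet V D ∈ eClass L D A := by
  obtain ⟨f, hf⟩ := exists_surjective_tasks L hM₀ hL n A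
  obtain ⟨c, hc⟩ := exists_witnesses hM hM₀ hS hF hne
    (fun i v x => (∃ y, ¬ RealizeIn L D (f i).2.1 (Fin.snoc (v ∘ (f i).2.2) y)) →
      ¬ RealizeIn L D (f i).2.1 (Fin.snoc (v ∘ (f i).2.2) x))
    (fun i => Set.range (f i).2.2) (fun i => Set.finite_range _)
    (fun i v v' x hvv' h => by
      have : v' ∘ (f i).2.2 = v ∘ (f i).2.2 := funext fun j => hvv' ⟨j, rfl⟩
      rwa [this])
    (fun i v => by
      by_cases h : ∃ y, ¬ RealizeIn L D (f i).2.1 (Fin.snoc (v ∘ (f i).2.2) y)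
      · obtain ⟨y, hy⟩ := h
        exact ⟨y, fun _ => hy⟩
      · exact ⟨i, fun h' => (h h').elim⟩)
  let V := Ultrafilter.of (F ⊓ elementaryFilter L M ⊓ ⨅ i, 𝓟 {v : M → M |
    (∃ y, ¬ RealizeIn L D (f i).2.1 (Fin.snoc (v ∘ (f i).2.2) y)) →
      ¬ RealizeIn L D (f i).2.1 (Fin.snoc (v ∘ (f i).2.2) (v (c i)))})
  have hV := Ultrafilter.of_le (F ⊓ elementaryFilter L M ⊓ ⨅ i, 𝓟 {v : M → M |
    (∃ y, ¬ RealizeIn L D (f i).2.1 (Fin.snoc (v ∘ (f i).2.2) y)) →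
      ¬ RealizeIn L D (f i).2.1 (Fin.snoc (v ∘ (f i).2.2) (v (c i)))})
  have hVF : (V : Filter (M → M)) ≤ F := hV.trans (inf_le_left.trans inf_le_left)
  refine ⟨V, hVF, fun φ => ?_⟩
  have htruth := realizeIn_limitSet (D := D) (hV.trans (inf_le_left.trans inf_le_right)) (hVF hFA)
    (fun k φ xs => by
      obtain ⟨i, hi⟩ := hf ⟨k, φ, xs⟩
      refine ⟨c i, ?_⟩
      have h := (hV.trans inf_le_right).trans (iInf_le _ i)
      rw [le_principal_iff, hi] at h
      exact h) φ default
  have hconst : ∀ v : M → M, v ∘ (default : Fin 0 → M) = default := fun v =>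
    Subsingleton.elim _ _
  simp only [hconst, eventually_const] at htruth
  exact htruth

end Expansion

/-! ### Shattering, approximability and external definability -/

section Shattering

variable {L : FirstOrder.Language.{u, v}} {M : Type w} [L.Structure M] {n : ℕ}

/-- If `a` is a finite tuple such that every formula over `A` true of `a` also holds of tuples with
the pattern `H` of membership in `D`, then this pattern is realized by `a` itself with respect to a
member of `e(D/A)`. -/
theorem exists_mem_eClass_pattern (hM : IsSaturated L M) (hM₀ : ℵ₀ < #M)
    (hL : Cardinal.lift.{w} L.card < Cardinal.lift.{max u v} #M) {A : Set M} (hA : #A < #M)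
    (D : Set (Fin n → M)) {k : ℕ} (a : Fin k → Fin n → M) (H : Set (Fin k))
    (ha : ∀ ψ : L.Formula (A ⊕ (Fin k × Fin n)),
      ψ.Realize (Sum.elim (↑) (Function.uncurry a)) →
        ∃ b : Fin k → Fin n → M, ψ.Realize (Sum.elim (↑) (Function.uncurry b)) ∧
          ∀ i, b i ∈ D ↔ i ∈ H) :
    ∃ C ∈ eClass L D A, ∀ i, a i ∈ C ↔ i ∈ H := by
  have : Nonempty M := Cardinal.mk_ne_zero_iff.1 (ne_bot_of_gt hM₀)
  let X : Set (M → M) := {v | (∀ s ∈ A, v s = s) ∧ ∀ i, v ∘ a i ∈ D ↔ i ∈ H}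
  let S : Set M := A ∪ Set.range (Function.uncurry a)
  have hS : #S < #M := (Cardinal.mk_union_le _ _).trans_lt
    (Cardinal.add_lt_of_lt hM₀.le hA ((Set.finite_range _).lt_aleph0.trans hM₀))
  have hXS : SupportedOn (𝓟 X) S := by
    refine supportedOn_principal fun v v' hvv' hv => ⟨fun s hs => ?_, fun i => ?_⟩
    · rw [hvv' (Or.inl hs), hv.1 s hs]
    · have : v' ∘ a i = v ∘ a i := funext fun j => hvv' (Or.inr ⟨(i, j), rfl⟩)
      rw [this, hv.2 i]
  have hne : (𝓟 X ⊓ elementaryFilter L M).NeBot := by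
    rw [inf_comm, inf_principal_neBot_iff]
    intro Y hY
    obtain ⟨χ, hχ, hχY⟩ := mem_elementaryFilter.1 hY
    obtain ⟨ψ, hψ⟩ := exists_projection (M := M) A (Function.uncurry a) χ
    obtain ⟨b, hb, hbH⟩ := ha ψ ((hψ _ _).2 ⟨id, fun _ => rfl, fun _ => rfl, hχ⟩)
    obtain ⟨v, hvA, hva, hvχ⟩ := (hψ _ _).1 hb
    refine ⟨v, hχY v hvχ, fun s hs => hvA ⟨s, hs⟩, fun i => ?_⟩
    have : v ∘ a i = b i := funext fun j => hva (i, j)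
    rw [this, hbH]
  obtain ⟨V, hV, hVe⟩ := exists_limitSet_mem_eClass hM hM₀ hL D hS hXS hne
    (Eventually.filter_mono le_rfl (mem_principal.2 fun v hv => hv.1))
  refine ⟨_, hVe, fun i => ?_⟩
  have hVX : ∀ᶠ v in (V : Filter (M → M)), v ∘ a i ∈ D ↔ i ∈ H :=
    hV (mem_principal.2 fun v hv => hv.2 i)
  change (∀ᶠ v in (V : Filter (M → M)), v ∘ a i ∈ D) ↔ i ∈ H
  rw [eventually_congr hVX, eventually_const]

/-- A tuple all of whose patterns of membership are realized in a family is shattered by it; its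
entries are distinct since some member contains exactly one of two given entries. -/
theorem not_finiteVCDim_of_patterns {X : Type w} {F : Set (Set X)}
    (h : ∀ k : ℕ, ∃ a : Fin k → X, ∀ H : Set (Fin k), ∃ C ∈ F, ∀ i, a i ∈ C ↔ i ∈ H) :
    ¬ FiniteVCDim F := by
  classical
  rintro ⟨k, hk⟩
  obtain ⟨a, ha⟩ := h k
  have hinj : Function.Injective a := by
    intro i j hij
    obtain ⟨C, -, hC⟩ := ha {i}
    exact ((hC j).1 (hij ▸ (hC i).2 rfl)).symm
  refine hk (Finset.univ.image a) ?_ fun H hH => ?_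
  · rw [Finset.card_image_of_injective _ hinj, Finset.card_univ, Fintype.card_fin]
  · obtain ⟨C, hCF, hC⟩ := ha (a ⁻¹' H)
    refine ⟨C, hCF, Set.Subset.antisymm ?_ fun x hx => ?_⟩
    · rintro x ⟨hxC, hx⟩
      obtain ⟨i, -, rfl⟩ := Finset.mem_image.1 (Finset.mem_coe.1 hx)
      exact (hC i).1 hxC
    · obtain ⟨i, -, rfl⟩ := Finset.mem_image.1 (Finset.mem_coe.1 (hH hx))
      exact ⟨(hC i).2 hx, hH hx⟩

theorem approximableFromBelow_of_finiteVCDim (hM : IsSaturated L M) (hM₀ : ℵ₀ < #M)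
    (hL : Cardinal.lift.{w} L.card < Cardinal.lift.{max u v} #M) {A : Set M} (hA : #A < #M)
    {D : Set (Fin n → M)} (hVC : FiniteVCDim (eClass L D A)) : ApproximableFromBelow L D := by
  by_contra hD
  refine not_finiteVCDim_of_patterns (fun k => ?_) hVC
  obtain ⟨a, ha⟩ := exists_independent_tuple hM hA hD k
  exact ⟨a, fun H => exists_mem_eClass_pattern hM hM₀ hL hA D a H (ha H)⟩

/-- The patterns of membership in the complement of `D` are the complements of the patterns of
membership in `D`, so finite VC-dimension also forces the complement to be approximable. -/
theorem approximableFromBelow_compl_of_finiteVCDim (hM : IsSaturated L M) (hM₀ : ℵ₀ < #M)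
    (hL : Cardinal.lift.{w} L.card < Cardinal.lift.{max u v} #M) {A : Set M} (hA : #A < #M)
    {D : Set (Fin n → M)} (hVC : FiniteVCDim (eClass L D A)) : ApproximableFromBelow L Dᶜ := by
  by_contra hD
  refine not_finiteVCDim_of_patterns (fun k => ?_) hVC
  obtain ⟨a, ha⟩ := exists_independent_tuple hM hA hD k
  refine ⟨a, fun H => exists_mem_eClass_pattern hM hM₀ hL hA D a H fun ψ hψ => ?_⟩
  obtain ⟨b, hb, hbH⟩ := ha Hᶜ ψ hψ
  exact ⟨b, hb, fun i => not_iff_not.1 (hbH i)⟩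

theorem approximableFromAbove_of_compl {D : Set (Fin n → M)} (h : ApproximableFromBelow L Dᶜ) :
    ApproximableFromAbove L D := by
  obtain ⟨m, φ, hφ⟩ := h
  refine ⟨m, φ.not, fun B hB => ?_⟩
  obtain ⟨b, h₁, h₂⟩ := hφ B hB
  have hfib : fiber φ.not b = (fiber φ b)ᶜ := rfl
  refine ⟨b, ?_, ?_⟩
  · rw [hfib]
    ext a
    have := Set.ext_iff.1 h₁ a
    simp only [Set.mem_inter_iff, Set.mem_compl_iff] at this ⊢
    tauto
  · rw [hfib]
    exact Set.subset_compl_comm.1 h₂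

theorem realize_plugIn {m : ℕ} (φ : L.Formula (Fin m ⊕ Fin n)) (a : Fin n → M) (b : Fin m → M) :
    (plugIn φ a).Realize b ↔ a ∈ fiber φ b := by
  rw [plugIn, Formula.Realize, BoundedFormula.realize_subst]
  change ((L.lhomWithConstants M).onFormula φ).Realize _ ↔ _
  rw [LHom.realize_onFormula]
  refine iff_of_eq (congrArg φ.Realize ?_)
  funext i
  rcases i with i | j
  · rfl
  · exact Term.realize_constants

/-- The instances of `φ` approximating `D` on larger and larger finite sets converge, along an
ultrafilter on the parameters, to the type of the class of the identity in an ultrapower of `M`. -/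
theorem ApproximableFromBelow.externallyDefinable [Nonempty M] {D : Set (Fin n → M)}
    (h : ApproximableFromBelow L D) : ExternallyDefinable L D := by
  classical
  obtain ⟨m, φ, hφ⟩ := h
  let P (B : Finset M) : Set (Fin m → M) :=
    {b | ∀ a ∈ power (B : Set M) n, a ∈ fiber φ b ↔ a ∈ D}
  have hP : ∀ B, (P B).Nonempty := by
    intro B
    obtain ⟨b, hb, -⟩ := hφ B B.finite_toSet
    refine ⟨b, fun a ha => ?_⟩
    have := Set.ext_iff.1 hb a
    simp only [Set.mem_inter_iff, ha, and_true] at this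
    exact this
  have hP_anti : ∀ B C, B ⊆ C → P C ⊆ P B := fun B C hBC b hb a ha =>
    hb a fun i => hBC (ha i)
  have : (⨅ B, 𝓟 (P B)).NeBot := by
    refine iInf_neBot_of_directed' (fun B C => ⟨B ∪ C, ?_, ?_⟩) fun B =>
      principal_neBot_iff.2 (hP B)
    · exact principal_mono.2 (hP_anti _ _ Finset.subset_union_left)
    · exact principal_mono.2 (hP_anti _ _ Finset.subset_union_right)
  let V : Ultrafilter (Fin m → M) := Ultrafilter.of (⨅ B, 𝓟 (P B))
  have hV : ∀ a, ∀ᶠ b in (V : Filter (Fin m → M)), a ∈ fiber φ b ↔ a ∈ D := by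
    intro a
    have h : (V : Filter (Fin m → M)) ≤ 𝓟 (P (Finset.univ.image a)) :=
      (Ultrafilter.of_le _).trans (iInf_le _ _)
    rw [le_principal_iff] at h
    filter_upwards [h] with b hb
    exact hb a fun i => by simp
  let N := (V : Filter (Fin m → M)).Product fun _ => M
  let : L[[M]].Structure N := Ultraproduct.structure
  have hN : N ⊨ L.elementaryDiagram M := by
    refine (Theory.model_iff _).2 fun σ hσ => ?_
    rw [Ultraproduct.sentence_realize]
    exact Eventually.of_forall fun _ => hσ
  let c : Fin m → N := fun i => ((fun b : Fin m → M => b i : (Fin m → M) → M) : N)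
  refine ⟨m, φ, (L.elementaryDiagram M).typeOf c, Set.ext fun a => ?_⟩
  change a ∈ D ↔ Formula.equivSentence (plugIn φ a) ∈ (L.elementaryDiagram M).typeOf c
  rw [Theory.CompleteType.mem_typeOf, Equiv.symm_apply_apply]
  have h : ∀ᶠ b in (V : Filter (Fin m → M)), (plugIn φ a).Realize b ↔ a ∈ D :=
    (hV a).mono fun b hb => (realize_plugIn φ a b).trans hb
  exact eventually_const.symm.trans ((eventually_congr h).symm.trans
    (Ultraproduct.realize_formula_cast (plugIn φ a) fun i (b : Fin m → M) => b i).symm)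

end Shattering

end ExtDef

theorem mainTheorem1 (L : FirstOrder.Language.{u, v}) (U : Type w) [L.Structure U]
    (hκ : (#U).IsInaccessible)
    (hL : Cardinal.lift.{w} L.card < Cardinal.lift.{max u v} #U)
    (hU : ExtDef.IsSaturated L U)
    (n : ℕ) (D : Set (Fin n → U))
    (A : Set U) (hA : #A < #U)
    (hVC : ExtDef.FiniteVCDim (ExtDef.eClass L D A)) :
    ExtDef.ApproximableFromBelow L D ∧ ExtDef.ApproximableFromAbove L D ∧
      ExtDef.ExternallyDefinable L D := by
  have hU₀ := hκ.aleph0_lt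
  have : Nonempty U := Cardinal.mk_ne_zero_iff.1 hκ.ne_zero
  have hbelow := ExtDef.approximableFromBelow_of_finiteVCDim hU hU₀ hL hA hVC
  exact ⟨hbelow, ExtDef.approximableFromAbove_of_compl
      (ExtDef.approximableFromBelow_compl_of_finiteVCDim hU hU₀ hL hA hVC),
    hbelow.externallyDefinable⟩
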